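/- Let $\mathbb{T}^2=\mathbb{R}^2/\mathbb{Z}^2$ with projection $\pi:\mathbb{R}^2\to\mathbb{T}^2$, let $\operatorname{Diff}^\infty(\mathbb{T}^2)$ be the space of all $C^\infty$ diffeomorphisms of $\mathbb{T}^2$ with the $C^\infty$ topology (uniform convergence of the maps and of all their derivatives), and let $\operatorname{Diff}^\infty_\mu(\mathbb{T}^2)$ be the subgroup of those that preserve the area measure $\mu$. For $\alpha\in\mathbb{T}^2$ let $R_\alpha(x)=x+\alpha$. Let $\overline{\mathcal{O}}^\infty(\mathbb{T}^2)$ be the closure in $\operatorname{Diff}^\infty(\mathbb{T}^2)$ of $$\{hR_\alpha h^{-1}: h\in\operatorname{Diff}^\infty(\mathbb{T}^2),\ \alpha\in\mathbb{T}^2\},$$ and let $\overline{\mathcal{O}}^\infty_\mu(\mathbb{T}^2)$ be its area-preserving counterpart, the closure in $\operatorname{Diff}^\infty(\mathbb{T}^2)$ of $$\{hR_\alpha h^{-1}: h\in\operatorname{Diff}^\infty_\mu(\mathbb{T}^2),\ \alpha\in\mathbb{T}^2\}.$$ Both carry the subspace topology. A homeomorphism $f$ of $\mathbb{T}^2$ is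 called weak spreading if it has a lift $\hat f:\mathbb{R}^2\to\mathbb{R}^2$ (a continuous map with $\pi\hat f=f\pi$) such that for every nonempty open set $U\subset\mathbb{R}^2$, every $\epsilon>0$ and every $N>0$ there is an integer $n>0$ such that $\hat f^n(U)$ is $\epsilon$-dense in some ball of radius $N$, that is, every point of that ball is at distance less than $\epsilon$ from $\hat f^n(U)$. Theorem. The set of weak spreading diffeomorphisms in $\overline{\mathcal{O}}^\infty(\mathbb{T}^2)$ is a dense $G_\delta$ subset of $\overline{\mathcal{O}}^\infty(\mathbb{T}^2)$, and the set of weak spreading diffeomorphisms in $\overline{\mathcal{O}}^\infty_\mu(\mathbb{T}^2)$ is a dense $G_\delta$ subset of $\overline{\mathcal{O}}^\infty_\mu(\mathbb{T}^2)$. -/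

import Mathlib

open Set Topology MeasureTheory
open scoped ContDiff

noncomputable section

/-- The Euclidean plane `ℝ²`. -/
abbrev Plane : Type := EuclideanSpace ℝ (Fin 2)

/-- The torus `𝕋² = ℝ² / ℤ²`; it carries its quotient topology and the area (Haar) measure
`volume` of total mass one. -/
abbrev Torus : Type := UnitAddTorus (Fin 2)

/-- The quotient projection `π : ℝ² → 𝕋²`. -/
def torusProj (x : Plane) : Torus := fun i => (x i : UnitAddCircle)

/-- `F : ℝ² → ℝ²` lifts `f : 𝕋² → 𝕋²`, that is, `f ∘ π = π ∘ F`. -/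
def IsTorusLift (F : Plane → Plane) (f : Torus → Torus) : Prop :=
  ∀ x, torusProj (F x) = f (torusProj x)

/-- A `C^∞` diffeomorphism of `𝕋²`: a homeomorphism such that it and its inverse have `C^∞` lifts
to `ℝ²`. As `π` is a local diffeomorphism, a continuous map of `𝕋²` is `C^∞` if and only if it has
a `C^∞` lift. All homotopy classes are allowed. -/
structure TorusDiffeo where
  toHomeomorph : Torus ≃ₜ Torus
  exists_lift : ∃ F : Plane → Plane, ContDiff ℝ ∞ F ∧ IsTorusLift F toHomeomorph
  exists_lift_symm : ∃ F : Plane → Plane, ContDiff ℝ ∞ F ∧ IsTorusLift F toHomeomorph.symm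

namespace TorusDiffeo

/-- A `C^∞` lift of a diffeomorphism of `𝕋²` (well defined up to an integer translation). -/
def lift (f : TorusDiffeo) : Plane → Plane := f.exists_lift.choose

theorem lift_contDiff (f : TorusDiffeo) : ContDiff ℝ ∞ f.lift := f.exists_lift.choose_spec.1

theorem lift_isTorusLift (f : TorusDiffeo) : IsTorusLift f.lift f.toHomeomorph :=
  f.exists_lift.choose_spec.2

/-- The derivative of order `r + 1` of `f`, computed in the coordinates of `ℝ²`. Since two lifts
differ by a constant, it does not depend on the lift. -/
def higherDeriv (r : ℕ) (f : TorusDiffeo) : C(Plane, Plane [×(r + 1)]→L[ℝ] Plane) where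
  toFun := iteratedFDeriv ℝ (r + 1) f.lift
  continuous_toFun := f.lift_contDiff.continuous_iteratedFDeriv (by exact_mod_cast le_top)

/-- The `C^∞` topology on `Diff^∞(𝕋²)`: uniform convergence of the maps together with all their
derivatives. Spaces of continuous maps carry the topology of uniform convergence on compact sets;
the derivatives are `ℤ²`-periodic, so for them this is uniform convergence on `ℝ²`. -/
instance : TopologicalSpace TorusDiffeo :=
  TopologicalSpace.induced (fun f => (f.toHomeomorph : C(Torus, Torus))) inferInstance ⊓
    ⨅ r : ℕ, TopologicalSpace.induced (higherDeriv r) inferInstance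

/-- `f` preserves the area of `𝕋²`. -/
def IsAreaPreserving (f : TorusDiffeo) : Prop :=
  MeasurePreserving f.toHomeomorph volume volume

/-- `f = h R_α h⁻¹`, where `R_α x = x + α`. -/
def IsConjTranslation (f h : TorusDiffeo) (α : Torus) : Prop :=
  ∀ x, f.toHomeomorph x = h.toHomeomorph (h.toHomeomorph.symm x + α)

end TorusDiffeo

/-- `{h R_α h⁻¹ : h ∈ Diff^∞(𝕋²), α ∈ 𝕋²}`, the conjugacy class of the translations. -/
def translationConj : Set TorusDiffeo :=
  {f | ∃ (h : TorusDiffeo) (α : Torus), f.IsConjTranslation h α}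

/-- `{h R_α h⁻¹ : h ∈ Diff^∞_μ(𝕋²), α ∈ 𝕋²}`, the conjugacy class of the translations in the
group of area-preserving diffeomorphisms. -/
def translationConjArea : Set TorusDiffeo :=
  {f | ∃ (h : TorusDiffeo) (α : Torus), h.IsAreaPreserving ∧ f.IsConjTranslation h α}

/-- `A` is `ε`-dense in `B`: every point of `B` is at distance less than `ε` from `A`. -/
def IsEpsDenseIn (ε : ℝ) (A B : Set Plane) : Prop :=
  ∀ y ∈ B, ∃ x ∈ A, dist x y < ε

/-- A homeomorphism `f` of `𝕋²` is weak spreading if, for a (continuous) lift `F` to `ℝ²`, for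
every nonempty open `U`, `ε > 0` and `N > 0` there is `n > 0` such that `F^n (U)` is `ε`-dense in
some ball of radius `N`. -/
def IsWeakSpreading (f : Torus ≃ₜ Torus) : Prop :=
  ∃ F : Plane → Plane, Continuous F ∧ IsTorusLift F f ∧
    ∀ U : Set Plane, IsOpen U → U.Nonempty → ∀ ε > (0 : ℝ), ∀ N > (0 : ℝ),
      ∃ n : ℕ, 0 < n ∧ ∃ z : Plane, IsEpsDenseIn ε (F^[n] '' U) (Metric.ball z N)

end

noncomputable section

open Filter

/-! ### The projection to the torus and uniqueness of lifts -/

/-! Weak spreading is a countable intersection of open conditions: it suffices to test `U` in a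
countable basis, `ε = 1/(k+1)` and closed balls of radius `m+1`. Compactness of the ball makes each
condition stable under small perturbations (`isOpen_spreadsBy`), and the choice of lift is
immaterial because two lifts of `f^n` differ by an integer vector.

Each condition is dense by an Anosov–Katok argument (`exists_spreadsBy_conj`). Given `φ R_β φ⁻¹`,
take `v ∈ (1/q)ℤ²` near `β`. The double shear `g` of frequency `q` preserves area and commutes with
`R_v`, so `φ R_v φ⁻¹ = (φg) R_v (φg)⁻¹`. Put `α = v + n⁻¹ (1/2q, 1/2q)` with `n` a large multiple of
`q`. Then `(φg) R_α (φg)⁻¹` is still close, but the `n`-th iterate of its lift is `φ g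
R_{(1/2q,1/2q)} g⁻¹ φ⁻¹` up to an integer translation. The half-period shift makes the shears
reinforce each other instead of cancelling: the image under `g R_{(1/2q,1/2q)} g⁻¹` of a ball of
radius `10/q` is `10/q`-dense in the concentric ball of radius `M`, for an amplitude depending on
`M` only (`exists_dist_conj_doubleShear_lt`).

Baire's theorem is applied in `LiftPair`, which is complete for the jets of a lift and of its
inverse; the continuous map `toDiffeo` carries the resulting dense set to `TorusDiffeo`
(`dense_isWeakSpreading`). -/

/-- An integer vector of the plane. -/
def intVec (k : Fin 2 → ℤ) : Plane := WithLp.toLp 2 fun i => (k i : ℝ)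

@[simp] theorem intVec_apply (k : Fin 2 → ℤ) (i : Fin 2) : intVec k i = k i := rfl

@[simp] theorem torusProj_apply (x : Plane) (i : Fin 2) : torusProj x i = (x i : UnitAddCircle) :=
  rfl

@[simp] theorem torusProj_add (x y : Plane) : torusProj (x + y) = torusProj x + torusProj y := by
  ext i; simp

@[simp] theorem torusProj_sub (x y : Plane) : torusProj (x - y) = torusProj x - torusProj y := by
  ext i; simp

@[simp] theorem torusProj_intVec (k : Fin 2 → ℤ) : torusProj (intVec k) = 0 := by
  ext i
  simp only [torusProj_apply, intVec_apply, Pi.zero_apply, AddCircle.coe_eq_zero_iff]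
  exact ⟨k i, by simp⟩

theorem torusProj_eq_iff {x y : Plane} :
    torusProj x = torusProj y ↔ ∃ k : Fin 2 → ℤ, y = x + intVec k := by
  constructor
  · intro h
    have h' : ∀ i, ∃ n : ℤ, n • (1 : ℝ) = y i - x i := fun i => by
      rw [← AddCircle.coe_eq_zero_iff, AddCircle.coe_sub, sub_eq_zero]
      exact (congrFun h i).symm
    choose k hk using h'
    refine ⟨k, ?_⟩
    ext i
    have := hk i
    simp only [zsmul_eq_mul, mul_one] at this
    simp [this]
  · rintro ⟨k, rfl⟩
    simp

theorem isOpenQuotientMap_torusProj : IsOpenQuotientMap torusProj :=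
  (IsOpenQuotientMap.piMap fun _ : Fin 2 =>
    (QuotientAddGroup.isOpenQuotientMap_mk :
      IsOpenQuotientMap (QuotientAddGroup.mk : ℝ → UnitAddCircle))).comp
    (PiLp.homeomorph 2 fun _ : Fin 2 => ℝ).isOpenQuotientMap

theorem continuous_torusProj : Continuous torusProj := isOpenQuotientMap_torusProj.continuous

theorem surjective_torusProj : Function.Surjective torusProj :=
  isOpenQuotientMap_torusProj.surjective

/-- The difference of the lifts is continuous with integer coordinates on a connected space. -/
theorem exists_eq_add_intVec_of_isTorusLift {f : Torus → Torus} {F G : Plane → Plane}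
    (hF : Continuous F) (hG : Continuous G) (hFf : IsTorusLift F f) (hGf : IsTorusLift G f) :
    ∃ k, ∀ x, G x = F x + intVec k := by
  have key : ∀ i, ∃ n : ℤ, ∀ x, G x i - F x i = n := fun i => by
    have hd : IsDiscrete (range ((↑) : ℤ → ℝ)) :=
      ⟨Int.isClosedEmbedding_coe_real.isEmbedding.toHomeomorph.symm.isEmbedding.discreteTopology⟩
    obtain ⟨_, ⟨n, rfl⟩, hn⟩ := isPreconnected_univ.eqOn_const_of_mapsTo hd
      (f := fun x : Plane => G x i - F x i) (by fun_prop) (fun x _ => by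
        obtain ⟨k, hk⟩ := torusProj_eq_iff.1 ((hFf x).trans (hGf x).symm)
        exact ⟨k i, by simp [hk]⟩) (range_nonempty _)
    exact ⟨n, fun x => hn (mem_univ x)⟩
  choose k hk using key
  refine ⟨k, fun x => ?_⟩
  ext i
  have := hk i x
  simp only [PiLp.add_apply, intVec_apply]
  linarith

theorem IsTorusLift.comp {f g : Torus → Torus} {F G : Plane → Plane} (hF : IsTorusLift F f)
    (hG : IsTorusLift G g) : IsTorusLift (F ∘ G) (f ∘ g) := fun x => by
  simp only [Function.comp_apply, hF (G x), hG x]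

theorem IsTorusLift.iterate {f : Torus → Torus} {F : Plane → Plane} (hF : IsTorusLift F f) (n : ℕ) :
    IsTorusLift F^[n] f^[n] := by
  induction n with
  | zero => exact fun _ => rfl
  | succ n ih => simpa only [Function.iterate_succ] using ih.comp hF

theorem IsTorusLift.exists_map_add_intVec {f : Torus → Torus} {F : Plane → Plane}
    (hF : Continuous F) (hFf : IsTorusLift F f) (k : Fin 2 → ℤ) :
    ∃ l, ∀ x, F (x + intVec k) = F x + intVec l :=
  exists_eq_add_intVec_of_isTorusLift hF (G := fun x => F (x + intVec k)) (by fun_prop) hFf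
    fun x => by rw [hFf]; simp

/-- The map of the torus induced by a map of the plane that is compatible with the projection. -/
def torusDescend (F : Plane → Plane) (z : Torus) : Torus :=
  torusProj (F (Function.surjInv surjective_torusProj z))

theorem isTorusLift_torusDescend {F : Plane → Plane}
    (hF : ∀ x y, torusProj x = torusProj y → torusProj (F x) = torusProj (F y)) :
    IsTorusLift F (torusDescend F) := fun _ =>
  hF _ _ (Function.surjInv_eq surjective_torusProj _).symm

theorem IsTorusLift.continuous {f : Torus → Torus} {F : Plane → Plane} (hFf : IsTorusLift F f)
    (hF : Continuous F) : Continuous f := by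
  rw [← isOpenQuotientMap_torusProj.continuous_comp_iff]
  exact (continuous_torusProj.comp hF).congr hFf

/-! ### Pairs of mutually inverse lifts -/

/-- A pair of mutually inverse smooth maps of the plane that descend to the torus. -/
@[ext] structure LiftPair where
  toFun : Plane → Plane
  invFun : Plane → Plane
  contDiff_toFun : ContDiff ℝ ∞ toFun
  contDiff_invFun : ContDiff ℝ ∞ invFun
  left_inv : ∀ x, invFun (toFun x) = x
  right_inv : ∀ x, toFun (invFun x) = x
  proj_toFun : ∀ x y, torusProj x = torusProj y → torusProj (toFun x) = torusProj (toFun y)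
  proj_invFun : ∀ x y, torusProj x = torusProj y → torusProj (invFun x) = torusProj (invFun y)

namespace LiftPair

theorem isTorusLift (φ : LiftPair) : IsTorusLift φ.toFun (torusDescend φ.toFun) :=
  isTorusLift_torusDescend φ.proj_toFun

theorem isTorusLift_inv (φ : LiftPair) : IsTorusLift φ.invFun (torusDescend φ.invFun) :=
  isTorusLift_torusDescend φ.proj_invFun

/-- The diffeomorphism of the torus with a given pair of lifts. -/
def toDiffeo (φ : LiftPair) : TorusDiffeo where
  toHomeomorph :=
    { toFun := torusDescend φ.toFun
      invFun := torusDescend φ.invFun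
      left_inv := fun z => by
        obtain ⟨x, rfl⟩ := surjective_torusProj z
        rw [← φ.isTorusLift, ← φ.isTorusLift_inv, φ.left_inv]
      right_inv := fun z => by
        obtain ⟨x, rfl⟩ := surjective_torusProj z
        rw [← φ.isTorusLift_inv, ← φ.isTorusLift, φ.right_inv]
      continuous_toFun := φ.isTorusLift.continuous φ.contDiff_toFun.continuous
      continuous_invFun := φ.isTorusLift_inv.continuous φ.contDiff_invFun.continuous }
  exists_lift := ⟨φ.toFun, φ.contDiff_toFun, φ.isTorusLift⟩
  exists_lift_symm := ⟨φ.invFun, φ.contDiff_invFun, φ.isTorusLift_inv⟩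

theorem toDiffeo_isTorusLift (φ : LiftPair) : IsTorusLift φ.toFun φ.toDiffeo.toHomeomorph :=
  φ.isTorusLift

theorem toDiffeo_isTorusLift_symm (φ : LiftPair) :
    IsTorusLift φ.invFun φ.toDiffeo.toHomeomorph.symm :=
  φ.isTorusLift_inv

/-- The composition of two pairs of lifts. -/
def comp (φ ψ : LiftPair) : LiftPair where
  toFun := φ.toFun ∘ ψ.toFun
  invFun := ψ.invFun ∘ φ.invFun
  contDiff_toFun := φ.contDiff_toFun.comp ψ.contDiff_toFun
  contDiff_invFun := ψ.contDiff_invFun.comp φ.contDiff_invFun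
  left_inv x := by simp [φ.left_inv, ψ.left_inv]
  right_inv x := by simp [φ.right_inv, ψ.right_inv]
  proj_toFun x y h := φ.proj_toFun _ _ (ψ.proj_toFun _ _ h)
  proj_invFun x y h := ψ.proj_invFun _ _ (φ.proj_invFun _ _ h)

/-- The inverse pair. -/
def symm (φ : LiftPair) : LiftPair where
  toFun := φ.invFun
  invFun := φ.toFun
  contDiff_toFun := φ.contDiff_invFun
  contDiff_invFun := φ.contDiff_toFun
  left_inv := φ.right_inv
  right_inv := φ.left_inv
  proj_toFun := φ.proj_invFun
  proj_invFun := φ.proj_toFun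

/-- The translation by `β`. -/
def translation (β : Plane) : LiftPair where
  toFun x := x + β
  invFun x := x - β
  contDiff_toFun := by fun_prop
  contDiff_invFun := by fun_prop
  left_inv x := by simp
  right_inv x := by simp
  proj_toFun x y h := by simp [h]
  proj_invFun x y h := by simp [h]

/-- The pair of lifts of `h R_β h⁻¹`. -/
def conj (φ : LiftPair) (β : Plane) : LiftPair := (φ.comp (translation β)).comp φ.symm

theorem conj_toFun (φ : LiftPair) (β x : Plane) :
    (φ.conj β).toFun x = φ.toFun (φ.invFun x + β) := rfl

theorem conj_invFun (φ : LiftPair) (β x : Plane) :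
    (φ.conj β).invFun x = φ.toFun (φ.invFun x - β) := rfl

theorem iterate_conj (φ : LiftPair) (β : Plane) (n : ℕ) (x : Plane) :
    (φ.conj β).toFun^[n] x = φ.toFun (φ.invFun x + (n : ℝ) • β) := by
  induction n with
  | zero => simp [φ.right_inv]
  | succ n ih =>
    rw [Function.iterate_succ_apply', ih, conj_toFun, φ.left_inv, add_assoc]
    push_cast
    rw [add_smul, one_smul]

theorem toDiffeo_comp_apply (φ ψ : LiftPair) (z : Torus) :
    (φ.comp ψ).toDiffeo.toHomeomorph z = φ.toDiffeo.toHomeomorph (ψ.toDiffeo.toHomeomorph z) := by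
  obtain ⟨x, rfl⟩ := surjective_torusProj z
  rw [← toDiffeo_isTorusLift, ← toDiffeo_isTorusLift, ← toDiffeo_isTorusLift]
  rfl

theorem isConjTranslation_conj (φ : LiftPair) (β : Plane) :
    (φ.conj β).toDiffeo.IsConjTranslation φ.toDiffeo (torusProj β) := fun z => by
  obtain ⟨x, rfl⟩ := surjective_torusProj z
  rw [← toDiffeo_isTorusLift, ← toDiffeo_isTorusLift_symm, ← torusProj_add, ← toDiffeo_isTorusLift]
  rfl

end LiftPair

theorem TorusDiffeo.ext_of_forall_apply {f g : TorusDiffeo}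
    (h : ∀ z, f.toHomeomorph z = g.toHomeomorph z) : f = g := by
  cases f; cases g
  congr
  exact Homeomorph.ext h

theorem LiftPair.exists_toDiffeo_eq (f : TorusDiffeo) : ∃ φ : LiftPair, φ.toDiffeo = f := by
  obtain ⟨F, hF, hFf⟩ := f.exists_lift
  obtain ⟨G, hG, hGf⟩ := f.exists_lift_symm
  obtain ⟨k, hk⟩ := exists_eq_add_intVec_of_isTorusLift (f := id) (F := id) continuous_id
    (hG.continuous.comp hF.continuous) (fun _ => rfl)
    (fun x => by simp [hGf (F x), hFf x])
  obtain ⟨l, hl⟩ := exists_eq_add_intVec_of_isTorusLift (f := id) (F := id) continuous_id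
    (hF.continuous.comp hG.continuous) (fun _ => rfl)
    (fun x => by simp [hGf x, hFf (G x)])
  simp only [Function.comp_apply, id] at hk hl
  -- `G` inverts `F` only up to the deck translation by `k`. Subtracting `k` gives a left inverse,
  -- which is two-sided because `hl` makes `F` surjective.
  have hl' : ∀ x, F (G x - intVec k) = x := fun x => by
    obtain ⟨y, rfl⟩ : ∃ y, F y = x := ⟨G (x - intVec l), by rw [hl]; abel⟩
    rw [hk, add_sub_cancel_right]
  refine ⟨⟨F, fun x => G x - intVec k, hF, by fun_prop, fun x => by simp [hk], hl',
    fun x y h => by rw [hFf, hFf, h], fun x y h => by simp [hGf x, hGf y, h]⟩, ?_⟩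
  refine TorusDiffeo.ext_of_forall_apply fun z => ?_
  obtain ⟨x, rfl⟩ := surjective_torusProj z
  rw [← LiftPair.toDiffeo_isTorusLift, ← hFf]

/-! ### Jets and the Baire property -/

/-- The space of sequences of candidates for the derivatives of all orders, with the topology of
locally uniform convergence. -/
abbrev JetSpace : Type := ∀ r : ℕ, C(Plane, Plane [×r]→L[ℝ] Plane)

namespace JetSpace

/-- The function underlying a jet. -/
def base (D : JetSpace) (x : Plane) : Plane := (D 0 x).curry0

/-- Each component is the derivative of the preceding one. -/
def IsHolonomic (D : JetSpace) : Prop :=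
  ∀ m x, HasFDerivAt (D m) (D (m + 1) x).curryLeft x

theorem IsHolonomic.hasFTaylorSeriesUpTo {D : JetSpace} (hD : D.IsHolonomic) :
    HasFTaylorSeriesUpTo ∞ D.base fun x r => D r x where
  zero_eq _ := rfl
  fderiv m _ x := hD m x
  cont m _ := (D m).continuous

/-- The jet of a smooth function. -/
def of (F : Plane → Plane) (hF : ContDiff ℝ ∞ F) : JetSpace := fun r =>
  ⟨iteratedFDeriv ℝ r F, hF.continuous_iteratedFDeriv (by exact_mod_cast le_top)⟩

theorem of_apply {F : Plane → Plane} (hF : ContDiff ℝ ∞ F) (r : ℕ) (x : Plane) :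
    of F hF r x = iteratedFDeriv ℝ r F x := rfl

theorem isHolonomic_of {F : Plane → Plane} (hF : ContDiff ℝ ∞ F) : (of F hF).IsHolonomic :=
  fun m x => (contDiff_iff_ftaylorSeries.1 hF).fderiv m (by exact_mod_cast ENat.natCast_lt_top m) x

theorem IsHolonomic.of_eq {D : JetSpace} (hD : D.IsHolonomic) (h : ContDiff ℝ ∞ D.base) :
    of D.base h = D := by
  funext r
  ext1 x
  exact (hD.hasFTaylorSeriesUpTo.eq_iteratedFDeriv (by exact_mod_cast le_top) x).symm

theorem continuous_base : Continuous fun p : JetSpace × Plane => p.1.base p.2 := by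
  have h : Continuous fun p : JetSpace × Plane => p.1 0 p.2 := by fun_prop
  exact (continuousMultilinearCurryFin0 ℝ Plane Plane).continuous.comp h

/-- Locally uniform convergence of the maps and of their derivatives lets differentiation pass to
the limit. -/
theorem isClosed_isHolonomic : IsClosed {D : JetSpace | D.IsHolonomic} := by
  refine isClosed_of_closure_subset fun D hD m x => ?_
  have := mem_closure_iff_nhdsWithin_neBot.1 hD
  have hcont : ∀ r, Tendsto (fun E : JetSpace => E r) (𝓝[{D | D.IsHolonomic}] D) (𝓝 (D r)) :=
    fun r => ((continuous_apply r).tendsto D).mono_left nhdsWithin_le_nhds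
  have h1 := ContinuousMap.tendsto_iff_tendstoLocallyUniformly.1 (hcont (m + 1))
  let e := continuousMultilinearCurryLeftEquiv ℝ (fun _ : Fin (m + 1) => Plane) Plane
  have h2 := e.isometry.uniformContinuous.comp_tendstoLocallyUniformly h1
  refine hasFDerivAt_of_tendstoUniformlyOnFilter (f := fun (E : JetSpace) y => E m y)
    (tendstoLocallyUniformly_iff_filter.1 h2 x) ?_ (.of_forall fun y => ?_)
  · exact (eventually_mem_nhdsWithin (a := D) (s := {D : JetSpace | D.IsHolonomic})).prod_inl _
      |>.mono fun p hp => hp m p.2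
  · have hy : Continuous fun f : C(Plane, Plane [×m]→L[ℝ] Plane) => f y := continuous_eval_const y
    exact (hy.tendsto _).comp (hcont m)

end JetSpace

instance : CompleteSpace (JetSpace × JetSpace) := CompleteSpace.prod

instance : IsCountablyGenerated (uniformity (JetSpace × JetSpace)) := by
  have : IsCountablyGenerated (uniformity JetSpace) := inferInstance
  rw [uniformity_prod]
  infer_instance

/-! ### The complete uniform space of pairs of lifts -/

namespace LiftPair

/-- The jets of both members of a pair of lifts. -/
def jets (φ : LiftPair) : JetSpace × JetSpace :=
  (.of φ.toFun φ.contDiff_toFun, .of φ.invFun φ.contDiff_invFun)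

/-- Controlling the inverse as well ensures that limits are again invertible, whence completeness.
-/
instance : UniformSpace LiftPair := .comap jets inferInstance

theorem isUniformInducing_jets : IsUniformInducing jets := ⟨rfl⟩

theorem continuous_jets : Continuous jets := isUniformInducing_jets.isInducing.continuous

theorem range_jets : range jets =
    {D : JetSpace × JetSpace | (D.1.IsHolonomic ∧ D.2.IsHolonomic) ∧
      ((∀ x, D.2.base (D.1.base x) = x) ∧ (∀ x, D.1.base (D.2.base x) = x)) ∧
      (∀ x y, torusProj x = torusProj y → torusProj (D.1.base x) = torusProj (D.1.base y)) ∧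
      ∀ x y, torusProj x = torusProj y → torusProj (D.2.base x) = torusProj (D.2.base y)} := by
  ext ⟨D, E⟩
  constructor
  · rintro ⟨φ, h⟩
    cases h
    exact ⟨⟨JetSpace.isHolonomic_of φ.contDiff_toFun, JetSpace.isHolonomic_of φ.contDiff_invFun⟩,
      ⟨φ.left_inv, φ.right_inv⟩, φ.proj_toFun, φ.proj_invFun⟩
  · rintro ⟨⟨hD, hE⟩, ⟨h1, h2⟩, h3, h4⟩
    have hD' := hD.hasFTaylorSeriesUpTo.contDiff
    have hE' := hE.hasFTaylorSeriesUpTo.contDiff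
    exact ⟨⟨D.base, E.base, hD', hE', h1, h2, h3, h4⟩, Prod.ext (hD.of_eq hD') (hE.of_eq hE')⟩

theorem isClosed_range_jets : IsClosed (range jets) := by
  rw [range_jets]
  have c1 : ∀ f : JetSpace × JetSpace → Plane, Continuous f →
      Continuous fun D : JetSpace × JetSpace => D.1.base (f D) := fun f hf =>
    JetSpace.continuous_base.comp (continuous_fst.prodMk hf)
  have c2 : ∀ f : JetSpace × JetSpace → Plane, Continuous f →
      Continuous fun D : JetSpace × JetSpace => D.2.base (f D) := fun f hf =>
    JetSpace.continuous_base.comp (continuous_snd.prodMk hf)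
  simp only [ofPred_and]
  refine .inter (.inter ?_ ?_) (.inter (.inter ?_ ?_) (.inter ?_ ?_))
  · exact JetSpace.isClosed_isHolonomic.preimage continuous_fst
  · exact JetSpace.isClosed_isHolonomic.preimage continuous_snd
  · simp only [ofPred_forall]
    exact isClosed_iInter fun x =>
      isClosed_eq (c2 _ (c1 _ continuous_const)) continuous_const
  · simp only [ofPred_forall]
    exact isClosed_iInter fun x =>
      isClosed_eq (c1 _ (c2 _ continuous_const)) continuous_const
  · simp only [ofPred_forall]
    exact isClosed_iInter fun x => isClosed_iInter fun y => isClosed_iInter fun _ =>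
      isClosed_eq (continuous_torusProj.comp (c1 _ continuous_const))
        (continuous_torusProj.comp (c1 _ continuous_const))
  · simp only [ofPred_forall]
    exact isClosed_iInter fun x => isClosed_iInter fun y => isClosed_iInter fun _ =>
      isClosed_eq (continuous_torusProj.comp (c2 _ continuous_const))
        (continuous_torusProj.comp (c2 _ continuous_const))

instance : CompleteSpace LiftPair :=
  isUniformInducing_jets.completeSpace isClosed_range_jets.isComplete

instance : IsCountablyGenerated (uniformity LiftPair) := by
  rw [← isUniformInducing_jets.comap_uniformity]
  infer_instance

theorem baireSpace_of_isClosed {C : Set LiftPair} (hC : IsClosed C) : BaireSpace C := by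
  have := hC.completeSpace_coe
  infer_instance

theorem continuous_toFun_uncurry : Continuous fun p : LiftPair × Plane => p.1.toFun p.2 :=
  JetSpace.continuous_base.comp
    ((continuous_fst.comp (continuous_jets.comp continuous_fst)).prodMk continuous_snd)

theorem continuous_toDiffeo : Continuous toDiffeo := by
  refine continuous_inf_rng.2 ⟨continuous_induced_rng.2 ?_, continuous_iInf_rng.2 fun r =>
    continuous_induced_rng.2 ?_⟩
  · refine ContinuousMap.continuous_of_continuous_uncurry _ ?_
    rw [← (IsOpenQuotientMap.id.prodMap isOpenQuotientMap_torusProj).continuous_comp_iff]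
    exact (continuous_torusProj.comp continuous_toFun_uncurry).congr
      fun p => p.1.toDiffeo_isTorusLift p.2
  -- The chosen `lift` differs from `φ.toFun` by a constant, which derivatives of positive order do
  -- not see.
  · have h : TorusDiffeo.higherDeriv r ∘ toDiffeo = fun φ => φ.jets.1 (r + 1) := by
      funext φ
      ext1 x
      obtain ⟨k, hk⟩ := exists_eq_add_intVec_of_isTorusLift φ.contDiff_toFun.continuous
        φ.toDiffeo.lift_contDiff.continuous φ.toDiffeo_isTorusLift φ.toDiffeo.lift_isTorusLift
      change iteratedFDeriv ℝ (r + 1) φ.toDiffeo.lift x = iteratedFDeriv ℝ (r + 1) φ.toFun x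
      have : φ.toDiffeo.lift = fun x => intVec k + φ.toFun x :=
        funext fun x => (hk x).trans (add_comm _ _)
      rw [iteratedFDeriv_succ_eq_comp_right, iteratedFDeriv_succ_eq_comp_right, this,
        funext fun x => fderiv_const_add (𝕜 := ℝ) (f := φ.toFun) (x := x) (intVec k)]
    rw [h]
    exact (continuous_apply (r + 1)).comp (continuous_fst.comp continuous_jets)

/-- The conjugate is smooth jointly in `(β, x)`; its derivatives in `x` are restrictions of the
joint ones, hence jointly continuous. -/
theorem continuous_jet_conj (φ : LiftPair) :
    Continuous fun β => JetSpace.of (φ.conj β).toFun (φ.conj β).contDiff_toFun := by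
  refine continuous_pi fun r => ContinuousMap.continuous_of_continuous_uncurry _ ?_
  let G : Plane × Plane → Plane := fun p => φ.toFun (φ.invFun p.2 + p.1)
  have hG : ContDiff ℝ ∞ G := φ.contDiff_toFun.comp
    ((φ.contDiff_invFun.comp contDiff_snd).add contDiff_fst)
  have key : ∀ β x, iteratedFDeriv ℝ r (φ.conj β).toFun x =
      (iteratedFDeriv ℝ r G (β, x)).compContinuousLinearMap
        fun _ => ContinuousLinearMap.inr ℝ Plane Plane := by
    intro β x
    have h1 : (φ.conj β).toFun =
        (fun p => G ((β, 0) + p)) ∘ ContinuousLinearMap.inr ℝ Plane Plane := by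
      funext y
      simp [G, conj_toFun]
    have hG' : ContDiff ℝ ∞ fun p => G ((β, 0) + p) := hG.comp (by fun_prop)
    rw [h1, ContinuousLinearMap.iteratedFDeriv_comp_right _ hG' x (by exact_mod_cast le_top),
      iteratedFDeriv_comp_add_left]
    simp
  refine Continuous.congr ?_ fun p => (key p.1 p.2).symm
  exact (ContinuousMultilinearMap.compContinuousLinearMapL (F := Plane)
    fun _ : Fin r => ContinuousLinearMap.inr ℝ Plane Plane).continuous.comp
      (hG.continuous_iteratedFDeriv (by exact_mod_cast le_top))

theorem continuous_conj (φ : LiftPair) : Continuous φ.conj := by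
  refine isUniformInducing_jets.isInducing.continuous_iff.2 (φ.continuous_jet_conj.prodMk ?_)
  refine (φ.continuous_jet_conj.comp continuous_neg).congr fun β => ?_
  funext r
  ext1 x
  have : (φ.conj (-β)).toFun = (φ.conj β).invFun := by
    funext y
    rw [conj_toFun, conj_invFun, sub_eq_add_neg]
  simp only [Function.comp_apply, JetSpace.of_apply, this]

end LiftPair

/-! ### Weak spreading is a countable intersection of open conditions -/

/-- The representative of a point of the torus in the fundamental square `(-1/2, 1/2]²`. -/
def torusSection (z : Torus) : Plane :=
  WithLp.toLp 2 fun i => (AddCircle.equivIoc (1 : ℝ) (-1 / 2) (z i) : ℝ)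

theorem torusProj_torusSection (z : Torus) : torusProj (torusSection z) = z := by
  ext i
  exact (AddCircle.equivIoc (1 : ℝ) (-1 / 2)).symm_apply_apply (z i)

theorem torusSection_zero : torusSection 0 = 0 := by
  ext i
  have h : (0 : ℝ) ∈ Ioc (-1 / 2 : ℝ) (-1 / 2 + 1) := by norm_num
  have := (AddCircle.equivIoc (1 : ℝ) (-1 / 2)).apply_symm_apply ⟨0, h⟩
  have h2 : (AddCircle.equivIoc (1 : ℝ) (-1 / 2)).symm ⟨0, h⟩ = 0 := rfl
  rw [h2] at this
  simp [torusSection, this]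

/-- The section jumps only where a coordinate is `-1/2` mod 1, away from `0`. This makes
`nearbyLift` continuous once `g - f` is uniformly small. -/
theorem eventually_continuousAt_torusSection :
    ∀ᶠ z in 𝓝 (0 : Torus), ContinuousAt torusSection z := by
  have h : ∀ i : Fin 2, ∀ᶠ z in 𝓝 (0 : Torus), z i ≠ ((-1 / 2 : ℝ) : UnitAddCircle) := fun i => by
    refine (continuous_apply i).continuousAt.eventually_ne fun h => ?_
    obtain ⟨n, hn⟩ := (AddCircle.coe_eq_zero_iff (1 : ℝ)).1 h.symm
    simp only [zsmul_eq_mul, mul_one] at hn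
    have : ((2 * n : ℤ) : ℝ) = ((-1 : ℤ) : ℝ) := by push_cast; linarith
    have := Int.cast_injective this
    omega
  filter_upwards [eventually_all.2 h] with z hz
  refine (PiLp.continuous_toLp 2 _).continuousAt.comp (continuousAt_pi.2 fun i => ?_)
  exact continuousAt_subtype_val.comp (ContinuousAt.comp (f := fun z : Torus => z i)
    (AddCircle.continuousAt_equivIoc (1 : ℝ) _ (hz i)) (continuous_apply i).continuousAt)

/-- A lift of a map near `f`, close to a given lift `F` of `f`. -/
def nearbyLift (F : Plane → Plane) (f g : C(Torus, Torus)) (x : Plane) : Plane :=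
  F x + torusSection (g (torusProj x) - f (torusProj x))

theorem isTorusLift_nearbyLift {F : Plane → Plane} {f : C(Torus, Torus)} (hF : IsTorusLift F f)
    (g : C(Torus, Torus)) : IsTorusLift (nearbyLift F f g) g := fun x => by
  rw [nearbyLift, torusProj_add, torusProj_torusSection, hF]
  abel

theorem eventually_forall_sub_mem {V : Set Torus} (hV : V ∈ 𝓝 0) (f : C(Torus, Torus)) :
    ∀ᶠ g in 𝓝 f, ∀ z, g z - f z ∈ V := by
  have := isCompact_univ.eventually_forall_of_forall_eventually (x₀ := f) (K := (univ : Set Torus))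
    (P := fun g z => g z - f z ∈ V) fun z _ => by
      have hc : Continuous fun p : C(Torus, Torus) × Torus => p.1 p.2 - f p.2 := by fun_prop
      exact hc.continuousAt.eventually_mem (by simpa using hV)
  simpa using this

theorem eventually_continuous_nearbyLift {F : Plane → Plane} (hF : Continuous F)
    (f : C(Torus, Torus)) : ∀ᶠ g in 𝓝 f, Continuous (nearbyLift F f g) := by
  filter_upwards [eventually_forall_sub_mem eventually_continuousAt_torusSection f] with g hg
  refine hF.add (continuous_iff_continuousAt.2 fun x => ?_)
  refine ContinuousAt.comp (f := fun x => g (torusProj x) - f (torusProj x)) (hg _) ?_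
  have := continuous_torusProj
  fun_prop

theorem tendstoUniformly_nearbyLift (F : Plane → Plane) (f : C(Torus, Torus)) :
    TendstoUniformly (nearbyLift F f) F (𝓝 f) := by
  refine Metric.tendstoUniformly_iff.2 fun ε hε => ?_
  have h := (eventually_continuousAt_torusSection.self_of_nhds).eventually
    (Metric.ball_mem_nhds _ hε)
  filter_upwards [eventually_forall_sub_mem h f] with g hg x
  simpa [nearbyLift, torusSection_zero] using hg (torusProj x)

/-- Some positive iterate of a lift of `f` maps `U` to a set that is `ε`-dense in a closed ball of
radius `N`. -/
def SpreadsBy (f : C(Torus, Torus)) (U : Set Plane) (ε N : ℝ) : Prop :=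
  ∃ F : Plane → Plane, Continuous F ∧ IsTorusLift F f ∧
    ∃ n : ℕ, 0 < n ∧ ∃ z : Plane, IsEpsDenseIn ε (F^[n] '' U) (Metric.closedBall z N)

theorem tendsto_iterate_of_tendstoUniformly {ι : Type*} {l : Filter ι} {G : ι → Plane → Plane}
    {F : Plane → Plane} (hF : Continuous F) (h : TendstoUniformly G F l) (n : ℕ) (x : Plane) :
    Tendsto (fun i => (G i)^[n] x) l (𝓝 (F^[n] x)) := by
  induction n with
  | zero => exact tendsto_const_nhds
  | succ n ih =>
    simp only [Function.iterate_succ_apply']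
    exact h.tendstoLocallyUniformly.tendsto_comp hF.continuousAt ih

/-- For fixed `n`, a point `x ∈ U` that serves `y` under `F` also serves all nearby `y` under the
lifts of all nearby maps; compactness of the closed ball makes the neighbourhood of `f` uniform in
`y`. -/
theorem isOpen_spreadsBy (U : Set Plane) (ε N : ℝ) : IsOpen {f | SpreadsBy f U ε N} := by
  refine isOpen_iff_mem_nhds.2 fun f hf => ?_
  obtain ⟨F, hF, hFf, n, hn, z, hz⟩ := hf
  have := (isCompact_closedBall z N).eventually_forall_of_forall_eventually (x₀ := f)
    (P := fun g y => ∃ x ∈ (nearbyLift F f g)^[n] '' U, dist x y < ε) fun y hy => by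
      obtain ⟨_, ⟨x, hx, rfl⟩, hxy⟩ := hz y hy
      have h1 := tendsto_iterate_of_tendstoUniformly hF (tendstoUniformly_nearbyLift F f) n x
      have h2 : Tendsto (fun p : C(Torus, Torus) × Plane => dist ((nearbyLift F f p.1)^[n] x) p.2)
          (𝓝 (f, y)) (𝓝 (dist (F^[n] x) y)) := by
        rw [nhds_prod_eq]
        exact (h1.comp tendsto_fst).dist tendsto_snd
      exact (h2.eventually_lt_const hxy).mono fun p hp => ⟨_, ⟨x, hx, rfl⟩, hp⟩
  filter_upwards [this, eventually_continuous_nearbyLift hF f] with g hg hgc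
  exact ⟨nearbyLift F f g, hgc, isTorusLift_nearbyLift hFf g, n, hn, z, hg⟩

theorem IsEpsDenseIn.mono {ε ε' : ℝ} {A A' B B' : Set Plane} (h : IsEpsDenseIn ε A B)
    (hε : ε ≤ ε') (hA : A ⊆ A') (hB : B' ⊆ B) : IsEpsDenseIn ε' A' B' := fun y hy => by
  obtain ⟨x, hx, hxy⟩ := h y (hB hy)
  exact ⟨x, hA hx, hxy.trans_le hε⟩

theorem IsWeakSpreading.spreadsBy {f : Torus ≃ₜ Torus} (hf : IsWeakSpreading f) {U : Set Plane}
    (hU : IsOpen U) (hne : U.Nonempty) {ε N : ℝ} (hε : 0 < ε) (hN : 0 < N) :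
    SpreadsBy f U ε N := by
  obtain ⟨F, hF, hFf, h⟩ := hf
  obtain ⟨n, hn, z, hz⟩ := h U hU hne ε hε (N + 1) (by linarith)
  exact ⟨F, hF, hFf, n, hn, z, hz.mono le_rfl subset_rfl
    (Metric.closedBall_subset_ball (by linarith))⟩

/-- Changing the lift translates the `n`-th iterate by an integer vector, so only the centre of the
ball moves. Hence one lift serves all indices at once. -/
theorem SpreadsBy.exists_isEpsDenseIn {f : C(Torus, Torus)} {U : Set Plane} {ε N : ℝ}
    (h : SpreadsBy f U ε N) {F : Plane → Plane} (hF : Continuous F) (hFf : IsTorusLift F f) :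
    ∃ n : ℕ, 0 < n ∧ ∃ z : Plane, IsEpsDenseIn ε (F^[n] '' U) (Metric.closedBall z N) := by
  obtain ⟨G, hG, hGf, n, hn, z, hz⟩ := h
  obtain ⟨k, hk⟩ := exists_eq_add_intVec_of_isTorusLift (hG.iterate n) (hF.iterate n)
    (hGf.iterate n) (hFf.iterate n)
  refine ⟨n, hn, z + intVec k, fun y hy => ?_⟩
  obtain ⟨_, ⟨x, hx, rfl⟩, hxy⟩ := hz (y - intVec k) (by
    rw [Metric.mem_closedBall, dist_eq_norm] at hy ⊢
    rwa [sub_sub, add_comm])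
  refine ⟨_, ⟨x, hx, rfl⟩, ?_⟩
  rw [dist_eq_norm] at hxy ⊢
  rw [hk]
  convert hxy using 2
  abel

/-- The nonempty members of a countable basis of the plane, together with two positive integers that
measure the density and the size. -/
abbrev SpreadIndex : Type :=
  {U : Set Plane // U ∈ TopologicalSpace.countableBasis Plane} × ℕ × ℕ

/-- The open condition attached to an index. -/
def SpreadIndex.Holds (i : SpreadIndex) (f : C(Torus, Torus)) : Prop :=
  SpreadsBy f i.1 (1 / (i.2.1 + 1)) (i.2.2 + 1)

instance : Countable SpreadIndex :=
  have : Countable {U : Set Plane // U ∈ TopologicalSpace.countableBasis Plane} :=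
    (TopologicalSpace.countable_countableBasis Plane).to_subtype
  inferInstance

theorem isWeakSpreading_iff (f : TorusDiffeo) : IsWeakSpreading f.toHomeomorph ↔
    ∀ i : SpreadIndex, i.Holds (f.toHomeomorph : C(Torus, Torus)) := by
  constructor
  · rintro h ⟨⟨U, hU⟩, k, m⟩
    exact h.spreadsBy (TopologicalSpace.isOpen_of_mem_countableBasis hU)
      (TopologicalSpace.nonempty_of_mem_countableBasis hU) (by positivity) (by positivity)
  · intro h
    refine ⟨f.lift, f.lift_contDiff.continuous, f.lift_isTorusLift, fun U hU ⟨x, hx⟩ ε hε N _ => ?_⟩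
    obtain ⟨V, hV, -, hVU⟩ :=
      (TopologicalSpace.isBasis_countableBasis Plane).exists_subset_of_mem_open hx hU
    obtain ⟨k, hk⟩ := exists_nat_one_div_lt hε
    obtain ⟨m, hm⟩ := exists_nat_gt N
    obtain ⟨n, hn, z, hz⟩ := (h ⟨⟨V, hV⟩, k, m⟩).exists_isEpsDenseIn f.lift_contDiff.continuous
      f.lift_isTorusLift
    refine ⟨n, hn, z, hz.mono hk.le (image_mono hVU) (Metric.ball_subset_closedBall.trans
      (Metric.closedBall_subset_closedBall ?_))⟩
    simp only
    linarith

theorem isOpen_holds (i : SpreadIndex) :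
    IsOpen {f : TorusDiffeo | i.Holds (f.toHomeomorph : C(Torus, Torus))} := by
  have h : Continuous fun f : TorusDiffeo => (f.toHomeomorph : C(Torus, Torus)) :=
    continuous_iff_le_induced.2 inf_le_left
  exact (isOpen_spreadsBy _ _ _).preimage h

theorem isGδ_isWeakSpreading : IsGδ {f : TorusDiffeo | IsWeakSpreading f.toHomeomorph} := by
  simp only [isWeakSpreading_iff, ofPred_forall]
  exact .iInter_of_isOpen isOpen_holds

theorem isGδ_isWeakSpreading_subtype (C : Set TorusDiffeo) :
    IsGδ {f : C | IsWeakSpreading f.1.toHomeomorph} :=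
  IsGδ.preimage (f := ((↑) : C → TorusDiffeo)) continuous_subtype_val isGδ_isWeakSpreading

/-! ### Shears -/

/-- The shear `x_i ↦ x_i + A sin (2π q x_j)`, where `j` is the other index. -/
def shearFun (i : Fin 2) (A : ℝ) (q : ℕ) (x : Plane) : Plane :=
  x + EuclideanSpace.single i (A * Real.sin (2 * Real.pi * q * x (i + 1)))

theorem fin_two_add_one_ne (i : Fin 2) : i + 1 ≠ i := by fin_cases i <;> decide

theorem shearFun_apply_same (i : Fin 2) (A : ℝ) (q : ℕ) (x : Plane) :
    shearFun i A q x i = x i + A * Real.sin (2 * Real.pi * q * x (i + 1)) := by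
  simp [shearFun]

theorem shearFun_apply_other (i : Fin 2) (A : ℝ) (q : ℕ) (x : Plane) :
    shearFun i A q x (i + 1) = x (i + 1) := by
  simp [shearFun]

theorem contDiff_shearFun (i : Fin 2) (A : ℝ) (q : ℕ) : ContDiff ℝ ∞ (shearFun i A q) := by
  refine contDiff_id.add (contDiff_euclidean.2 fun j => ?_)
  have h : ContDiff ℝ ∞ fun x : Plane => A * Real.sin (2 * Real.pi * q * x (i + 1)) := by fun_prop
  by_cases hj : j = i
  · subst hj
    simpa using h
  · simpa [hj] using contDiff_const

theorem shearFun_neg_shearFun (i : Fin 2) (A : ℝ) (q : ℕ) (x : Plane) :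
    shearFun i (-A) q (shearFun i A q x) = x := by
  rw [shearFun, shearFun_apply_other, shearFun, add_assoc]
  ext j
  by_cases hj : j = i
  · subst hj; simp
  · simp [hj]

/-- `v` is a vector with coordinates in `(1/q) ℤ`. -/
def IsFracVec (q : ℕ) (v : Plane) : Prop := ∀ i, ∃ m : ℤ, q * v i = m

theorem isFracVec_intVec (q : ℕ) (k : Fin 2 → ℤ) : IsFracVec q (intVec k) := fun i =>
  ⟨q * k i, by simp⟩

/-- Used twice: integer `v` lets the shear descend to the torus, fractional `v` gives the
commutation behind the conjugation argument. -/
theorem shearFun_add (i : Fin 2) (A : ℝ) {q : ℕ} {v : Plane} (hv : IsFracVec q v) (x : Plane) :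
    shearFun i A q (x + v) = shearFun i A q x + v := by
  obtain ⟨m, hm⟩ := hv (i + 1)
  have : 2 * Real.pi * q * (x + v) (i + 1) =
      2 * Real.pi * q * x (i + 1) + m * (2 * Real.pi) := by
    rw [PiLp.add_apply, ← hm]
    ring
  rw [shearFun, this, Real.sin_add_int_mul_two_pi, shearFun]
  abel

/-- The shear as a pair of lifts. -/
def shear (i : Fin 2) (A : ℝ) (q : ℕ) : LiftPair where
  toFun := shearFun i A q
  invFun := shearFun i (-A) q
  contDiff_toFun := contDiff_shearFun i A q
  contDiff_invFun := contDiff_shearFun i (-A) q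
  left_inv := shearFun_neg_shearFun i A q
  right_inv x := by simpa using shearFun_neg_shearFun i (-A) q x
  proj_toFun x y h := by
    obtain ⟨k, rfl⟩ := torusProj_eq_iff.1 h
    simp [shearFun_add _ _ (isFracVec_intVec q k)]
  proj_invFun x y h := by
    obtain ⟨k, rfl⟩ := torusProj_eq_iff.1 h
    simp [shearFun_add _ _ (isFracVec_intVec q k)]

/-- With coordinate `i` split off, this is a skew product whose fibre maps are rotations of the
circle. -/
theorem measurePreserving_update_add {ψ : UnitAddCircle → UnitAddCircle} (hψ : Measurable ψ)
    (i : Fin 2) : MeasurePreserving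
      (fun z : Torus => Function.update z i (z i + ψ (z (i + 1)))) volume volume := by
  let e := MeasurableEquiv.piFinSuccAbove (fun _ : Fin 2 => UnitAddCircle) i
  have he : MeasurePreserving e volume volume :=
    volume_preserving_piFinSuccAbove (fun _ : Fin 2 => UnitAddCircle) i
  have h1 : MeasurePreserving (fun p : (Fin 1 → UnitAddCircle) × UnitAddCircle =>
      (p.1, p.2 + ψ (p.1 0))) (volume.prod volume) (volume.prod volume) :=
    (MeasurePreserving.id volume).skew_product
      (g := fun (a : Fin 1 → UnitAddCircle) b => b + ψ (a 0)) (by fun_prop)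
      (.of_forall fun a => (measurePreserving_add_right volume (ψ (a 0))).map_eq)
  have h2 : MeasurePreserving (fun p : UnitAddCircle × (Fin 1 → UnitAddCircle) =>
      (p.1 + ψ (p.2 0), p.2)) volume volume :=
    Measure.measurePreserving_swap.comp (h1.comp Measure.measurePreserving_swap)
  have h3 := (he.symm e).comp (h2.comp he)
  suffices key : (fun z : Torus => Function.update z i (z i + ψ (z (i + 1)))) =
      e.symm ∘ (fun p => (p.1 + ψ (p.2 0), p.2)) ∘ e by
    rw [key]
    exact h3
  funext z
  apply e.injective
  simp only [Function.comp_apply, MeasurableEquiv.apply_symm_apply]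
  have hs : i.succAbove 0 = i + 1 := by fin_cases i <;> rfl
  refine Prod.ext ?_ (funext fun j => ?_)
  · simp [e, MeasurableEquiv.piFinSuccAbove, Fin.insertNthEquiv, Fin.removeNth, hs]
  · obtain rfl : j = 0 := Subsingleton.elim _ _
    simp [e, MeasurableEquiv.piFinSuccAbove, Fin.insertNthEquiv, Fin.removeNth, hs]

theorem isAreaPreserving_shear (i : Fin 2) (A : ℝ) (q : ℕ) :
    (shear i A q).toDiffeo.IsAreaPreserving := by
  let f := (shear i A q).toDiffeo.toHomeomorph
  -- Reading the displacement off `f` itself, where the `i`-th coordinate is `0`, makes it well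
  -- defined and continuous on the circle.
  let ψ : UnitAddCircle → UnitAddCircle := fun u => f (Function.update 0 (i + 1) u) i
  have hψ : Continuous ψ := by fun_prop
  have hval : ∀ x : Plane,
      ψ (x (i + 1) : ℝ) = ((A * Real.sin (2 * Real.pi * q * x (i + 1)) : ℝ) : UnitAddCircle) := by
    intro x
    have h : Function.update (0 : Torus) (i + 1) ((x (i + 1) : ℝ) : UnitAddCircle) =
        torusProj (EuclideanSpace.single (i + 1) (x (i + 1))) := by
      ext j
      by_cases hj : j = i + 1
      · subst hj; simp
      · simp [hj]
    simp only [ψ, h, f]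
    rw [← LiftPair.toDiffeo_isTorusLift, torusProj_apply]
    change ((shearFun i A q _ i : ℝ) : UnitAddCircle) = _
    rw [shearFun_apply_same]
    simp [(fin_two_add_one_ne i).symm]
  have key : ⇑f = fun z : Torus => Function.update z i (z i + ψ (z (i + 1))) := by
    funext z
    obtain ⟨x, rfl⟩ := surjective_torusProj z
    simp only [f]
    rw [← LiftPair.toDiffeo_isTorusLift]
    ext j
    by_cases hj : j = i
    · subst hj
      simp only [torusProj_apply, Function.update_self, hval, ← AddCircle.coe_add]
      exact congrArg _ (shearFun_apply_same j A q x)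
    · rw [Function.update_of_ne hj]
      obtain rfl : j = i + 1 := by omega
      exact congrArg _ (shearFun_apply_other i A q x)
  change MeasurePreserving f volume volume
  rw [key]
  exact measurePreserving_update_add hψ.measurable i

theorem LiftPair.isAreaPreserving_comp {φ ψ : LiftPair} (hφ : φ.toDiffeo.IsAreaPreserving)
    (hψ : ψ.toDiffeo.IsAreaPreserving) : (φ.comp ψ).toDiffeo.IsAreaPreserving := by
  have h : ⇑(φ.comp ψ).toDiffeo.toHomeomorph =
      φ.toDiffeo.toHomeomorph ∘ ψ.toDiffeo.toHomeomorph := funext (φ.toDiffeo_comp_apply ψ)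
  unfold TorusDiffeo.IsAreaPreserving at *
  rw [h]
  exact hφ.comp hψ

/-- A vertical shear followed by a horizontal one. -/
def doubleShear (A : ℝ) (q : ℕ) : LiftPair := (shear 0 A q).comp (shear 1 A q)

theorem isAreaPreserving_doubleShear (A : ℝ) (q : ℕ) :
    (doubleShear A q).toDiffeo.IsAreaPreserving :=
  LiftPair.isAreaPreserving_comp (isAreaPreserving_shear 0 A q) (isAreaPreserving_shear 1 A q)

theorem doubleShear_toFun_add (A : ℝ) {q : ℕ} {v : Plane} (hv : IsFracVec q v) (x : Plane) :
    (doubleShear A q).toFun (x + v) = (doubleShear A q).toFun x + v := by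
  change shearFun 0 A q (shearFun 1 A q (x + v)) = shearFun 0 A q (shearFun 1 A q x) + v
  rw [shearFun_add _ _ hv, shearFun_add _ _ hv]

/-- The vector `(1 / 2q, 1 / 2q)`. -/
def halfVec (q : ℕ) : Plane := WithLp.toLp 2 fun _ => 1 / (2 * (q : ℝ))

/-- The inverse horizontal shear is trivial at height `m / q`. The half-period shift in `s` flips
the sign of the sine, so the two vertical displacements add up to `-2A sin` instead of cancelling.
-/
theorem conj_doubleShear_apply (A : ℝ) {q : ℕ} (hq : 0 < q) (m : ℤ) (s : ℝ) :
    ((doubleShear A q).conj (halfVec q)).toFun !₂[s, m / q] =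
      !₂[s + 1 / (2 * q) +
          A * Real.sin (2 * Real.pi * q * (2 * A * Real.sin (2 * Real.pi * q * s))),
        m / q + 1 / (2 * q) - 2 * A * Real.sin (2 * Real.pi * q * s)] := by
  have hq' : (q : ℝ) ≠ 0 := by positivity
  have h1 : shearFun 0 (-A) q !₂[s, m / q] = !₂[s, m / q] := by
    have : 2 * Real.pi * q * (m / q : ℝ) = ((2 * m : ℤ) : ℝ) * Real.pi := by
      push_cast; field_simp
    have h : Real.sin (2 * Real.pi * q * (m / q : ℝ)) = 0 := by rw [this, Real.sin_int_mul_pi]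
    simp [shearFun, h]
  have h2 : shearFun 1 (-A) q !₂[s, m / q] =
      !₂[s, m / q - A * Real.sin (2 * Real.pi * q * s)] := by
    ext j; fin_cases j <;> simp [shearFun, sub_eq_add_neg]
  have h3 : !₂[s, m / q - A * Real.sin (2 * Real.pi * q * s)] + halfVec q =
      !₂[s + 1 / (2 * q), m / q - A * Real.sin (2 * Real.pi * q * s) + 1 / (2 * q)] := by
    ext j; fin_cases j <;> simp [halfVec]
  have h4 : shearFun 1 A q
      !₂[s + 1 / (2 * q), m / q - A * Real.sin (2 * Real.pi * q * s) + 1 / (2 * q)] =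
      !₂[s + 1 / (2 * q), m / q + 1 / (2 * q) - 2 * A * Real.sin (2 * Real.pi * q * s)] := by
    have : 2 * Real.pi * q * (s + 1 / (2 * q)) = 2 * Real.pi * q * s + Real.pi := by
      field_simp
    ext j
    fin_cases j
    · simp [shearFun]
    · have h : shearFun 1 A q !₂[s + 1 / (2 * q),
          m / q - A * Real.sin (2 * Real.pi * q * s) + 1 / (2 * q)] 1 =
          m / q - A * Real.sin (2 * Real.pi * q * s) + 1 / (2 * q) +
            A * Real.sin (2 * Real.pi * q * (s + 1 / (2 * q))) := by
        simpa using shearFun_apply_same 1 A q !₂[s + 1 / (2 * q),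
          m / q - A * Real.sin (2 * Real.pi * q * s) + 1 / (2 * q)]
      change shearFun 1 A q _ 1 = _
      rw [h, this, Real.sin_add_pi]
      simp
      ring
  rw [LiftPair.conj_toFun]
  change shearFun 0 A q (shearFun 1 A q (shearFun 1 (-A) q (shearFun 0 (-A) q _) + _)) = _
  rw [h1, h2, h3, h4]
  have h5 : ∀ θ : ℝ, Real.sin (2 * Real.pi * q * (m / q + 1 / (2 * q) - θ)) =
      Real.sin (2 * Real.pi * q * θ) := by
    intro θ
    have : 2 * Real.pi * q * (m / q + 1 / (2 * q) - θ) =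
        Real.pi - 2 * Real.pi * q * θ + m * (2 * Real.pi) := by
      field_simp
      ring
    rw [this, Real.sin_add_int_mul_two_pi, Real.sin_pi_sub]
  ext j
  fin_cases j
  · change shearFun 0 A q _ 0 = _
    rw [shearFun_apply_same]
    simp only [zero_add]
    change _ + A * Real.sin (2 * Real.pi * q * (m / q + 1 / (2 * q) -
      2 * A * Real.sin (2 * Real.pi * q * s))) = _
    rw [h5]
    rfl
  · exact shearFun_apply_other 0 A q _

/-- Every value in `[-1, 1]` is taken by `sin (2π q ·)` close to any given point. -/
theorem exists_sin_eq {q : ℕ} (hq : 0 < q) {c : ℝ} (hc : |c| ≤ 1) (v₀ : ℝ) :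
    ∃ v, |v - v₀| ≤ 2 / q ∧ Real.sin (2 * Real.pi * q * v) = c := by
  have hq' : (0 : ℝ) < q := by positivity
  have hpi := Real.pi_pos
  -- The arcsine solution, moved to the period containing `v₀`; the error is at most `(1 + 1/4) /
  -- q`.
  refine ⟨(⌊q * v₀⌋ + Real.arcsin c / (2 * Real.pi)) / q, ?_, ?_⟩
  · have h1 := Int.floor_le (q * v₀)
    have h2 := Int.lt_floor_add_one (q * v₀)
    have h3 : Real.arcsin c / (2 * Real.pi) ≤ 1 / 4 := by
      rw [div_le_iff₀ (by positivity)]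
      linarith [Real.arcsin_le_pi_div_two c]
    have h4 : -(1 / 4) ≤ Real.arcsin c / (2 * Real.pi) := by
      rw [le_div_iff₀ (by positivity)]
      linarith [Real.neg_pi_div_two_le_arcsin c]
    have : (⌊q * v₀⌋ + Real.arcsin c / (2 * Real.pi)) / q - v₀ =
        (⌊q * v₀⌋ + Real.arcsin c / (2 * Real.pi) - q * v₀) / q := by
      field_simp
    rw [this, abs_div, abs_of_pos hq']
    gcongr
    rw [abs_le]
    constructor <;> linarith
  · have : 2 * Real.pi * q * ((⌊q * v₀⌋ + Real.arcsin c / (2 * Real.pi)) / q) =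
        Real.arcsin c + ⌊q * v₀⌋ * (2 * Real.pi) := by
      field_simp
      ring
    rw [this, Real.sin_add_int_mul_two_pi]
    exact Real.sin_arcsin (abs_le.1 hc).1 (abs_le.1 hc).2

theorem EuclideanSpace.dist_le_abs_add_abs (x y : Plane) :
    dist x y ≤ |x 0 - y 0| + |x 1 - y 1| := by
  rw [EuclideanSpace.dist_eq, Fin.sum_univ_two, Real.dist_eq, Real.dist_eq]
  refine Real.sqrt_le_iff.2 ⟨by positivity, ?_⟩
  nlinarith [abs_nonneg (x 0 - y 0), abs_nonneg (x 1 - y 1)]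

/-- The conjugate by the double shear of the translation by `(1 / 2q, 1 / 2q)` spreads small balls
over large ones. -/
theorem exists_dist_conj_doubleShear_lt {q : ℕ} (hq : 0 < q) {M A : ℝ} (hA : M + 6 ≤ A)
    (w y : Plane) (hy : dist y w ≤ M) :
    ∃ x, dist x w < 10 / q ∧ dist (((doubleShear A q).conj (halfVec q)).toFun x) y < 10 / q := by
  have hq' : (0 : ℝ) < q := by positivity
  have hq1 : (1 : ℝ) ≤ q := by exact_mod_cast hq
  have hinv : 1 / (q : ℝ) ≤ 1 := by rw [div_le_one hq']; exact hq1
  have hM : 0 ≤ M := dist_nonneg.trans hy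
  have hA0 : 0 < A := by linarith
  have hcoord : ∀ i, |y i - w i| ≤ M := fun i => by
    refine (PiLp.norm_apply_le (y - w) i).trans ?_
    rwa [← dist_eq_norm]
  have e2 : (2 : ℝ) / q = 2 * (1 / q) := by ring
  have e10 : (10 : ℝ) / q = 10 * (1 / q) := by ring
  have ehalf : 1 / (2 * (q : ℝ)) = 1 / 2 * (1 / q) := by field_simp
  have hinv0 : 0 < 1 / (q : ℝ) := by positivity
  obtain ⟨m, hm⟩ : ∃ m : ℤ, |(m : ℝ) / q - w 1| ≤ 1 / q := by
    refine ⟨⌊q * w 1⌋, ?_⟩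
    have : (⌊q * w 1⌋ : ℝ) / q - w 1 = (⌊q * w 1⌋ - q * w 1) / q := by field_simp
    rw [this, abs_div, abs_of_pos hq']
    gcongr
    rw [abs_le]
    constructor <;> linarith [Int.floor_le (q * w 1), Int.lt_floor_add_one (q * w 1)]
  -- The system is solved backwards: `v` is the wanted value of `2A sin(2πqs)`. It is nearly the
  -- required vertical displacement and gives exactly the horizontal displacement `y 0 - w 0`.
  obtain ⟨v, hv, hvs⟩ := exists_sin_eq hq (c := (y 0 - w 0) / A)
    (by rw [abs_div, abs_of_pos hA0, div_le_one hA0]; linarith [hcoord 0])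
    (m / q + 1 / (2 * q) - y 1)
  -- `|v| ≤ M + 2 + 1 + 1/2`, which is where `A ≥ M + 6` leaves room.
  have hv2 : |v / (2 * A)| ≤ 1 := by
    rw [abs_div, abs_of_pos (by positivity : 0 < 2 * A), div_le_one (by positivity), abs_le]
    have := abs_le.1 hv
    have := abs_le.1 hm
    have := abs_le.1 (hcoord 1)
    constructor <;> linarith
  obtain ⟨s, hs, hss⟩ := exists_sin_eq hq hv2 (w 0)
  refine ⟨!₂[s, m / q], ?_, ?_⟩
  · refine (EuclideanSpace.dist_le_abs_add_abs _ _).trans_lt ?_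
    change |s - w 0| + |(m : ℝ) / q - w 1| < _
    linarith
  · have h2A : 2 * A * (v / (2 * A)) = v := by field_simp
    rw [conj_doubleShear_apply A hq, hss, h2A, hvs]
    refine (EuclideanSpace.dist_le_abs_add_abs _ _).trans_lt ?_
    change |s + 1 / (2 * q) + A * ((y 0 - w 0) / A) - y 0| + |m / q + 1 / (2 * q) - v - y 1| < _
    have h0 : s + 1 / (2 * q) + A * ((y 0 - w 0) / A) - y 0 = (s - w 0) + 1 / (2 * q) := by
      field_simp
      ring
    have h1 : m / q + 1 / (2 * q) - v - y 1 = -(v - (m / q + 1 / (2 * q) - y 1)) := by ring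
    have h3 : |1 / (2 * (q : ℝ))| = 1 / (2 * q) := abs_of_pos (by positivity)
    rw [h0, h1, abs_neg]
    have := abs_add_le (s - w 0) (1 / (2 * (q : ℝ)))
    linarith

/-! ### Density -/

theorem tendsto_floor_mul_div (β : Plane) :
    Tendsto (fun q : ℕ => (WithLp.toLp 2 fun i => (⌊q * β i⌋ : ℝ) / q : Plane)) atTop (𝓝 β) := by
  refine ((PiLp.continuous_toLp 2 fun _ : Fin 2 => ℝ).tendsto (fun i => β i)).comp
    (tendsto_pi_nhds.2 fun i => ?_)
  refine tendsto_iff_dist_tendsto_zero.2 (squeeze_zero' (.of_forall fun _ => dist_nonneg) ?_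
    tendsto_one_div_atTop_nhds_zero_nat)
  filter_upwards [eventually_gt_atTop 0] with q hq
  have hq' : (0 : ℝ) < q := by positivity
  have : (⌊q * β i⌋ : ℝ) / q - β i = (⌊q * β i⌋ - q * β i) / q := by field_simp
  rw [Real.dist_eq, this, abs_div, abs_of_pos hq']
  gcongr
  rw [abs_le]
  constructor <;> linarith [Int.floor_le (q * β i), Int.lt_floor_add_one (q * β i)]

theorem isFracVec_floor_mul_div (q : ℕ) (β : Plane) :
    IsFracVec q (WithLp.toLp 2 fun i => (⌊q * β i⌋ : ℝ) / q) := fun i => by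
  rcases eq_or_ne q 0 with rfl | hq
  · exact ⟨0, by simp⟩
  · exact ⟨⌊q * β i⌋, by simp only; field_simp⟩

theorem tendsto_add_inv_smul (v t : Plane) {q : ℕ} (hq : 0 < q) :
    Tendsto (fun m : ℕ => v + ((q * (m + 1) : ℕ) : ℝ)⁻¹ • t) atTop (𝓝 v) := by
  have h1 : Tendsto (fun m : ℕ => q * (m + 1)) atTop atTop :=
    (tendsto_add_atTop_nat 1).const_mul_atTop' hq
  have h2 := ((tendsto_inv_atTop_nhds_zero_nat (𝕜 := ℝ)).comp h1).smul_const t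
  simpa using h2.const_add v

theorem doubleShear_conj_of_isFracVec (A : ℝ) {q : ℕ} {v : Plane} (hv : IsFracVec q v) (x : Plane) :
    (doubleShear A q).toFun ((doubleShear A q).invFun x + v) = x + v := by
  rw [doubleShear_toFun_add A hv, (doubleShear A q).right_inv]

namespace LiftPair

/-- The double shear commutes with the translation by `v`, so inserting it changes nothing until `v`
is perturbed. -/
theorem conj_comp_doubleShear_of_isFracVec (φ : LiftPair) (A : ℝ) {q : ℕ} {v : Plane}
    (hv : IsFracVec q v) : (φ.comp (doubleShear A q)).conj v = φ.conj v := by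
  have hv' : IsFracVec q (-v) := fun i => by
    obtain ⟨m, hm⟩ := hv i
    exact ⟨-m, by simp [hm]⟩
  ext1
  · funext x
    exact congrArg φ.toFun (doubleShear_conj_of_isFracVec A hv (φ.invFun x))
  · funext x
    rw [conj_invFun, conj_invFun, sub_eq_add_neg, sub_eq_add_neg]
    exact congrArg φ.toFun (doubleShear_conj_of_isFracVec A hv' (φ.invFun x))

/-- After conjugation by a suitable double shear, translations close to a translation by a vector
with denominator `q` spread a given open set. -/
theorem spreadsBy_conj_comp_doubleShear (φ : LiftPair) {A : ℝ} {q m : ℕ} {v : Plane}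
    (hv : IsFracVec q v) (hq : 0 < q) {U : Set Plane} {w : Plane} {ε N M ρ δ : ℝ}
    (hρ : ∀ x, dist x w < ρ → φ.toFun x ∈ U)
    (hM : ∀ y, dist y (φ.toFun w) ≤ N → dist (φ.invFun y) w ≤ M)
    (hδ : ∀ x y, dist y w ≤ M → dist x y < δ → dist (φ.toFun x) (φ.toFun y) < ε)
    (hA : M + 6 ≤ A) (hqρ : 10 / (q : ℝ) < ρ) (hqδ : 10 / (q : ℝ) < δ) :
    SpreadsBy (((φ.comp (doubleShear A q)).conj
      (v + ((q * (m + 1) : ℕ) : ℝ)⁻¹ • halfVec q)).toDiffeo.toHomeomorph) U ε N := by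
  set g := doubleShear A q
  set n := q * (m + 1)
  have hn : 0 < n := by positivity
  have hn' : (n : ℝ) ≠ 0 := by positivity
  refine ⟨_, contDiff_toFun _ |>.continuous, toDiffeo_isTorusLift _, n, hn, ?_⟩
  choose p hp using hv
  have hnv : (n : ℝ) • v = intVec fun i => (m + 1) * p i := by
    ext i
    have := hp i
    simp only [PiLp.smul_apply, smul_eq_mul, intVec_apply, n]
    push_cast
    rw [← this]
    ring
  obtain ⟨l, hl⟩ := φ.toDiffeo_isTorusLift.exists_map_add_intVec φ.contDiff_toFun.continuous
    fun i => (m + 1) * p i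
  -- After `n` steps the rational part `n • v` is an integer vector and the perturbation has
  -- accumulated to exactly `halfVec q`.
  have hiter : ∀ x, ((φ.comp g).conj (v + (n : ℝ)⁻¹ • halfVec q)).toFun^[n] (φ.toFun x) =
      φ.toFun ((g.conj (halfVec q)).toFun x) + intVec l := by
    intro x
    rw [iterate_conj, smul_add, smul_inv_smul₀ hn', hnv]
    change φ.toFun (g.toFun (g.invFun (φ.invFun (φ.toFun x)) + _)) = _
    rw [φ.left_inv, add_comm (intVec _), ← add_assoc,
      doubleShear_toFun_add A (isFracVec_intVec q _), hl]
    rfl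
  refine ⟨φ.toFun w + intVec l, fun y hy => ?_⟩
  have hy' : dist (φ.invFun (y - intVec l)) w ≤ M := hM _ (by
    rw [Metric.mem_closedBall, dist_eq_norm] at hy
    rwa [dist_eq_norm, sub_sub, add_comm (intVec l)])
  obtain ⟨x, hxw, hxy⟩ := exists_dist_conj_doubleShear_lt hq hA w _ hy'
  refine ⟨_, ⟨φ.toFun x, hρ x (hxw.trans hqρ), rfl⟩, ?_⟩
  rw [hiter]
  have := hδ _ _ hy' (hxy.trans hqδ)
  rw [φ.right_inv, dist_eq_norm] at this
  rw [dist_eq_norm]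
  convert this using 2
  abel

/-- The order of choices matters: `M`, hence the amplitude `M + 6`, depends only on `φ`, `N` and a
point of `U`; then `q` is taken large, and `m` last, with the shear already fixed. -/
theorem exists_spreadsBy_conj (φ : LiftPair) (β : Plane) {V : Set LiftPair} (hV : V ∈ 𝓝 (φ.conj β))
    {U : Set Plane} (hU : IsOpen U) (hne : U.Nonempty) {ε : ℝ} (hε : 0 < ε) (N : ℝ) :
    ∃ A q α, (φ.comp (doubleShear A q)).conj α ∈ V ∧
      SpreadsBy (((φ.comp (doubleShear A q)).conj α).toDiffeo.toHomeomorph) U ε N := by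
  obtain ⟨u, hu⟩ := hne
  set w := φ.invFun u
  obtain ⟨ρ, hρ0, hρ⟩ := Metric.isOpen_iff.1 (hU.preimage φ.contDiff_toFun.continuous) w
    (by simpa only [mem_preimage, w, φ.right_inv] using hu)
  obtain ⟨M, hM⟩ := ((isCompact_closedBall (φ.toFun w) N).image
    φ.contDiff_invFun.continuous).isBounded.subset_closedBall w
  obtain ⟨δ, hδ0, hδ⟩ := Metric.mem_uniformity_dist.1
    ((isCompact_closedBall w M).uniformContinuousAt_of_continuousAt φ.toFun
      (fun a _ => φ.contDiff_toFun.continuous.continuousAt) (Metric.dist_mem_uniformity hε))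
  -- `V` must be a neighbourhood of `φ.conj v`, not merely contain it, because `α` will tend to `v`
  -- rather than to `β`.
  have h1 := ((φ.continuous_conj.tendsto β).comp (tendsto_floor_mul_div β)).eventually
    (eventually_eventually_nhds.2 hV)
  have h2 := (tendsto_const_div_atTop_nhds_zero_nat (10 : ℝ)).eventually_lt_const (lt_min hρ0 hδ0)
  obtain ⟨q, hqV, hqr, hq⟩ := (h1.and (h2.and (eventually_gt_atTop 0))).exists
  have hv := isFracVec_floor_mul_div q β
  set v : Plane := WithLp.toLp 2 fun i => (⌊q * β i⌋ : ℝ) / q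
  have h3 : Tendsto (fun m : ℕ => (φ.comp (doubleShear (M + 6) q)).conj
      (v + ((q * (m + 1) : ℕ) : ℝ)⁻¹ • halfVec q)) atTop (𝓝 (φ.conj v)) := by
    rw [← φ.conj_comp_doubleShear_of_isFracVec (M + 6) hv]
    exact ((continuous_conj _).tendsto _).comp (tendsto_add_inv_smul v _ hq)
  obtain ⟨m, hm⟩ := (h3.eventually hqV).exists
  refine ⟨M + 6, q, _, hm, φ.spreadsBy_conj_comp_doubleShear hv hq (fun x hx => hρ hx)
    (fun y hy => hM ⟨y, hy, rfl⟩) (fun x y hy hxy => ?_) le_rfl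
    (hqr.trans_le (min_le_left _ _)) (hqr.trans_le (min_le_right _ _))⟩
  have := hδ (a := y) (b := x) (by rwa [dist_comm]) hy
  rw [dist_comm]
  exact this

end LiftPair

/-! ### The Baire argument -/

/-- The diffeomorphisms `h R_α h⁻¹` with `h ∈ H`. -/
def translationConjOf (H : Set TorusDiffeo) : Set TorusDiffeo :=
  {f | ∃ h ∈ H, ∃ α, f.IsConjTranslation h α}

/-- Stability of `H` under right composition with area-preserving maps is all that inserting double
shears needs, so both classes are covered. Baire's theorem is used on the closure of the conjugates
inside `LiftPair`. -/
theorem dense_isWeakSpreading {H : Set TorusDiffeo}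
    (hH : ∀ φ ψ : LiftPair, φ.toDiffeo ∈ H → ψ.toDiffeo.IsAreaPreserving →
      (φ.comp ψ).toDiffeo ∈ H) :
    Dense {f : closure (translationConjOf H) | IsWeakSpreading f.1.toHomeomorph} := by
  let S : Set LiftPair := {s | ∃ φ : LiftPair, φ.toDiffeo ∈ H ∧ ∃ β, s = φ.conj β}
  have hS : MapsTo LiftPair.toDiffeo S (translationConjOf H) := by
    rintro _ ⟨φ, hφ, β, rfl⟩
    exact ⟨_, hφ, _, φ.isConjTranslation_conj β⟩
  have hclos := hS.closure LiftPair.continuous_toDiffeo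
  have := LiftPair.baireSpace_of_isClosed (isClosed_closure (s := S))
  let V : SpreadIndex → Set (closure S) :=
    fun i => {s | i.Holds (s.1.toDiffeo.toHomeomorph : C(Torus, Torus))}
  have hVo : ∀ i, IsOpen (V i) := fun i =>
    (isOpen_holds i).preimage (LiftPair.continuous_toDiffeo.comp continuous_subtype_val)
  have hVd : ∀ i, Dense (V i) := by
    intro i
    refine Subtype.dense_iff.2 (closure_minimal ?_ isClosed_closure)
    rintro _ ⟨φ, hφ, β, rfl⟩
    refine mem_closure_iff_nhds.2 fun W hW => ?_
    obtain ⟨A, q, α, hW', hs⟩ := φ.exists_spreadsBy_conj β hW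
      (TopologicalSpace.isOpen_of_mem_countableBasis i.1.2)
      (TopologicalSpace.nonempty_of_mem_countableBasis i.1.2)
      (ε := 1 / (i.2.1 + 1)) (by positivity) (i.2.2 + 1)
    exact ⟨_, hW', ⟨⟨_, subset_closure
      ⟨_, hH _ _ hφ (isAreaPreserving_doubleShear A q), α, rfl⟩⟩, hs, rfl⟩⟩
  have hd := Subtype.dense_iff.1 (dense_iInter_of_isOpen hVo hVd)
  refine Subtype.dense_iff.2 (closure_minimal ?_ isClosed_closure)
  rintro f ⟨h, hh, α, hf⟩
  obtain ⟨φ, rfl⟩ := LiftPair.exists_toDiffeo_eq h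
  obtain ⟨β, rfl⟩ := surjective_torusProj α
  obtain rfl : (φ.conj β).toDiffeo = f := TorusDiffeo.ext_of_forall_apply fun z =>
    (φ.isConjTranslation_conj β z).trans (hf z).symm
  -- Every conjugate of a translation comes from `S`, so continuity of `toDiffeo` suffices; the
  -- topologies need not be compared further.
  refine map_mem_closure LiftPair.continuous_toDiffeo (hd (subset_closure ⟨φ, hh, β, rfl⟩)) ?_
  rintro _ ⟨s, hs, rfl⟩
  refine ⟨⟨s.1.toDiffeo, hclos s.2⟩, ?_, rfl⟩
  exact (isWeakSpreading_iff _).2 fun i => mem_iInter.1 hs i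

theorem translationConj_eq : translationConj = translationConjOf univ := by
  ext f
  simp [translationConj, translationConjOf]

theorem translationConjArea_eq :
    translationConjArea = translationConjOf {h | h.IsAreaPreserving} := by
  ext f
  simp [translationConjArea, translationConjOf]

end

theorem theorem1 :
    (IsGδ {f : closure translationConj | IsWeakSpreading f.1.toHomeomorph} ∧
      Dense {f : closure translationConj | IsWeakSpreading f.1.toHomeomorph}) ∧
    (IsGδ {f : closure translationConjArea | IsWeakSpreading f.1.toHomeomorph} ∧
      Dense {f : closure translationConjArea | IsWeakSpreading f.1.toHomeomorph}) := by
  refine ⟨⟨isGδ_isWeakSpreading_subtype _, ?_⟩,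
    ⟨isGδ_isWeakSpreading_subtype _, ?_⟩⟩
  · rw [translationConj_eq]
    exact dense_isWeakSpreading fun _ _ _ _ => mem_univ _
  · rw [translationConjArea_eq]
    exact dense_isWeakSpreading fun _ _ => LiftPair.isAreaPreserving_comp
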